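/- Let $R$ be an associative ring with identity; modules are unital right $R$-modules, and $\mathrm{Mod}\text{-}R$ denotes the class of all of them. For modules $M,N$, say that $M$ is $N$-subprojective if for every epimorphism $g:B\to N$ and every homomorphism $f:M\to N$ there is a homomorphism $h:M\to B$ with $gh=f$. The subprojectivity domain of $M$ is the class $$\underline{\mathfrak{Pr}}^{-1}(M)=\{N\in\mathrm{Mod}\text{-}R : M\text{ is }N\text{-subprojective}\}.$$ A class $\mathcal C$ of modules is an sp-portfolio if $\mathcal C=\underline{\mathfrak{Pr}}^{-1}(M)$ for some module $M$. An sp-portfolio $\mathcal C$ is basic if there is a module $M$ with $\mathcal C=\underline{\mathfrak{Pr}}^{-1}(M)=\{N : \mathrm{Hom}_R(M,N)=0\}$. A torsion theory is a pair $(\mathcal T,\mathcal F)$ of classes of modules such that (i) $\mathrm{Hom}_R(M,N)=0$ for all $M\in\mathcal T$, $N\in\mathcal F$; (ii) if $\mathrm{Hom}_R(A,N)=0$ for all $N\in\mathcal F$, then $A\in\mathcal T$; (iii) if $\mathrm{Hom}_R(M,B)=0$ for all $M\in\mathcal T$, then $B\in\mathcal F$. A torsion-free class is the second component $\mathcal F$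 of some torsion theory. The ring $R$ is semiprimary if its Jacobson radical $J(R)$ is nilpotent and $R/J(R)$ is semisimple artinian; right hereditary if submodules of projective right $R$-modules are projective; left coherent if every finitely generated left ideal of $R$ is finitely presented. Proposition. The following are equivalent: 1. $R$ is semiprimary, right hereditary and left coherent. 2. Every sp-portfolio is basic. 3. Every sp-portfolio is a torsion-free class. -/

import Mathlib

universe u

namespace Subproj

/-- The category of right modules over `R`: left modules over the opposite ring. -/
abbrev RMod (R : Type u) [Ring R] : Type (u + 1) := ModuleCat.{u} Rᵐᵒᵖ

/-- Right hereditary: every submodule of a projective right `R`-module is projective. -/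
def IsRightHereditary (R : Type u) [Ring R] : Prop :=
  ∀ P : RMod R, Module.Projective Rᵐᵒᵖ P →
    ∀ N : Submodule Rᵐᵒᵖ P, Module.Projective Rᵐᵒᵖ N

/-- Left coherent: every finitely generated left ideal is finitely presented
(`Ideal R` is the type of left ideals). -/
def IsLeftCoherent (R : Type u) [Ring R] : Prop :=
  ∀ I : Ideal R, I.FG → Module.FinitePresentation R I

variable {R : Type u} [Ring R]

/-- `Hom_R(M, N) = 0`. -/
def HomZero (M N : RMod R) : Prop :=
  ∀ f : M →ₗ[Rᵐᵒᵖ] N, f = 0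

/-- `M` is `N`-subprojective: every homomorphism `M → N` lifts along every epimorphism onto `N`. -/
def IsSubprojective (M N : RMod R) : Prop :=
  ∀ (B : RMod R) (g : B →ₗ[Rᵐᵒᵖ] N), Function.Surjective g →
    ∀ f : M →ₗ[Rᵐᵒᵖ] N, ∃ h : M →ₗ[Rᵐᵒᵖ] B, g ∘ₗ h = f

/-- The subprojectivity domain of `M`. -/
def subprojDomain (M : RMod R) : Set (RMod R) :=
  {N | IsSubprojective M N}

/-- A class of right modules is an sp-portfolio if it is the subprojectivity domain
of some module. -/
def IsSpPortfolio (C : Set (RMod R)) : Prop :=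
  ∃ M : RMod R, C = subprojDomain M

/-- A basic sp-portfolio: the subprojectivity domain of a module `M` for which it
coincides with the class of all `N` with `Hom_R(M, N) = 0`. -/
def IsBasic (C : Set (RMod R)) : Prop :=
  ∃ M : RMod R, C = subprojDomain M ∧ subprojDomain M = {N | HomZero M N}

/-- `(T, F)` is a torsion theory. -/
structure IsTorsionTheory (T F : Set (RMod R)) : Prop where
  homZero : ∀ M ∈ T, ∀ N ∈ F, HomZero M N
  mem_torsion : ∀ A : RMod R, (∀ N ∈ F, HomZero A N) → A ∈ T
  mem_torsionFree : ∀ B : RMod R, (∀ M ∈ T, HomZero M B) → B ∈ F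

/-- `F` is the torsion-free class of some torsion theory. -/
def IsTorsionFreeClass (F : Set (RMod R)) : Prop :=
  ∃ T : Set (RMod R), IsTorsionTheory T F

end Subproj

-- All three conditions are equivalent to `ProjectiveSubmodulesOfPowers`: every submodule of a power
-- of the right module $R$ is projective. Over a left coherent ring, powers of $R$ are flat. Flat
-- modules over a semiprimary ring are projective, and heredity passes this on to submodules. Given
-- projectivity of submodules of powers, the image of $M\to R^{\mathrm{Hom}(M,R)}$ is projective. So
-- $M$ is the direct sum of a projective module and a module $K$ with $\mathrm{Hom}(K,R)=0$, and $K$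
-- shows that the domain of $M$ is basic. A basic class is a right orthogonal, hence torsion-free.
-- If sp-portfolios are torsion-free classes, the domain of $N\subseteq R^\iota$ contains $R$, hence
-- $N$ itself, so the identity of $N$ lifts to a free cover. The hardest step derives semiprimarity
-- from projective submodules of powers. Chase's argument gives the descending chain condition on
-- principal left ideals, so $R/J$ is semisimple and $J$ is T-nilpotent. Idempotent generators of
-- the right annihilators of the $J^n$ then make $J$ nilpotent.

universe v w

namespace Subproj

/-! ### Projectivity modulo a nilpotent ideal -/

/-- If `F` is projective, `F / JF` is semisimple for a nilpotent ideal `J`, and the kernel `K` of an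
epimorphism `F → M` satisfies `K ∩ JF ⊆ JK`, then `M` is projective. -/
theorem projective_of_ker_inf_smul_top_le {S : Type u} [Ring S] {F : Type v} {M : Type w}
    [AddCommGroup F] [Module S F] [AddCommGroup M] [Module S M] [Module.Projective S F]
    {J : Ideal S} (hJ : IsNilpotent J) [IsSemisimpleModule S (F ⧸ (J • ⊤ : Submodule S F))]
    {p : F →ₗ[S] M} (hp : Function.Surjective p)
    (h : LinearMap.ker p ⊓ J • ⊤ ≤ J • LinearMap.ker p) : Module.Projective S M := by
  set K := LinearMap.ker p with hK
  let JK : Submodule S K := J • ⊤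
  let q : K →ₗ[S] F ⧸ (J • ⊤ : Submodule S F) := Submodule.mkQ _ ∘ₗ K.subtype
  have hle : JK ≤ LinearMap.ker q := by
    rw [LinearMap.ker_comp, Submodule.ker_mkQ]
    exact le_trans (smul_mono_right J (by simp)) (Submodule.smul_comap_le_comap_smul _ _ _)
  have hker : LinearMap.ker q ≤ JK := by
    intro k hk
    rw [LinearMap.ker_comp, Submodule.ker_mkQ] at hk
    exact (Submodule.mem_smul_top_iff J K k).2 (h ⟨k.2, hk⟩)
  -- `K / JK` embeds in the semisimple `F / JF`, so it is a retract; projectivity of `F` lifts the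
  -- retraction to `g : F → K`, which on `K` is the identity modulo `JK`.
  obtain ⟨r, hr⟩ := IsSemisimpleModule.extension_property (JK.liftQ q hle)
    (LinearMap.ker_eq_bot.1 (Submodule.ker_liftQ_eq_bot _ _ _ hker)) LinearMap.id
  obtain ⟨g, hg⟩ := Module.projective_lifting_property JK.mkQ (r ∘ₗ Submodule.mkQ _)
    JK.mkQ_surjective
  have hgk : ∀ k : K, k - g k ∈ JK := by
    intro k
    rw [← Submodule.Quotient.mk_eq_zero, Submodule.Quotient.mk_sub, sub_eq_zero]
    have h1 := LinearMap.congr_fun hr (Submodule.Quotient.mk k)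
    have h2 := LinearMap.congr_fun hg (k : F)
    exact h1.symm.trans h2.symm
  -- The error `n` of `g` on `K` maps `K` into `JK`, so it is nilpotent and `g` restricts to a unit
  -- of `End K`; composing `g` with its inverse splits `K` off `F`.
  let n : Module.End S K := 1 - g ∘ₗ K.subtype
  have hn : LinearMap.range n ≤ JK := by
    rintro _ ⟨k, rfl⟩
    exact hgk k
  have hpow : ∀ t : ℕ, LinearMap.range (n ^ t) ≤ J ^ t • (⊤ : Submodule S K) := by
    intro t
    induction t with
    | zero => simp [Submodule.pow_zero, Ideal.one_eq_top]
    | succ t ih =>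
      rw [pow_succ', Module.End.mul_eq_comp, LinearMap.range_comp]
      refine (Submodule.map_mono ih).trans ?_
      rw [Submodule.map_smul'', Submodule.map_top, Submodule.pow_succ, Submodule.mul_smul]
      exact smul_mono_right _ hn
  obtain ⟨t, ht⟩ := hJ
  have hnil : IsNilpotent n := by
    refine ⟨t, LinearMap.range_eq_bot.1 (le_bot_iff.1 ((hpow t).trans ?_))⟩
    rw [ht]
    simp
  obtain ⟨u, hu⟩ := hnil.isUnit_one_sub
  have hu' : (u : Module.End S K) = g ∘ₗ K.subtype := by rw [hu]; simp [n]
  let ρ : F →ₗ[S] K := (↑u⁻¹ : Module.End S K) ∘ₗ g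
  have hρ : ∀ k : K, ρ k = k := by
    intro k
    have : (↑u⁻¹ * ↑u : Module.End S K) k = k := by simp
    rw [hu'] at this
    exact this
  have hsplit : K ≤ LinearMap.ker (LinearMap.id - K.subtype ∘ₗ ρ) := by
    intro k hk
    have := hρ ⟨k, hk⟩
    simp [this]
  let e : (F ⧸ K) ≃ₗ[S] M := p.quotKerEquivOfSurjective hp
  refine Module.Projective.of_split (K.liftQ _ hsplit ∘ₗ e.symm.toLinearMap) p ?_
  ext m
  obtain ⟨f, rfl⟩ := hp m
  have : e.symm (p f) = Submodule.Quotient.mk f := by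
    rw [LinearEquiv.symm_apply_eq]; rfl
  have h0 : p (ρ f : F) = 0 := (ρ f).2
  simp [this, h0]

/-! ### Flatness of powers and coherence -/

/-- The equational criterion for flatness: every finite relation among elements of `M` comes from
relations in `S`. -/
def IsEquationallyFlat (S : Type u) [Ring S] (M : Type v) [AddCommGroup M] [Module S M] : Prop :=
  ∀ (n : ℕ) (s : Fin n → S) (m : Fin n → M), ∑ i, s i • m i = 0 →
    ∃ (k : ℕ) (t : Fin n → Fin k → S) (m' : Fin k → M),
      (∀ i, m i = ∑ j, t i j • m' j) ∧ ∀ j, ∑ i, s i * t i j = 0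

/-- This is the vanishing of $\mathrm{Tor}_1(S/J,M)$. Subtracting lifts of the elements given by the
criterion moves each vector of a combination in `JF` into the kernel without changing the
combination. -/
theorem IsEquationallyFlat.ker_inf_smul_top_le {S : Type u} [Ring S] {F : Type v} {M : Type w}
    [AddCommGroup F] [Module S F] [AddCommGroup M] [Module S M] (hM : IsEquationallyFlat S M)
    {J : Ideal S} [J.IsTwoSided] {p : F →ₗ[S] M} (hp : Function.Surjective p) :
    LinearMap.ker p ⊓ J • ⊤ ≤ J • LinearMap.ker p := by
  rintro x ⟨hx, hxJ⟩
  have htop : (⊤ : Submodule S F) = Submodule.span S (Set.range id) := by simp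
  rw [SetLike.mem_coe, htop, Submodule.mem_ideal_smul_span_iff_exists_sum] at hxJ
  obtain ⟨a, ha, hax⟩ := hxJ
  let e := a.support.equivFin.symm
  have hsum : ∑ i, a (e i) • (e i : F) = x := by
    rw [← hax, Finsupp.sum, ← Finset.sum_coe_sort a.support]
    exact e.sum_comp (fun y : a.support => a y • (y : F))
  have hrel : ∑ i, a (e i) • p (e i) = 0 := by
    have : p x = 0 := hx
    rw [← hsum] at this
    simpa using this
  obtain ⟨k, t, m', hm', ht⟩ := hM _ (fun i => a (e i)) (fun i => p (e i)) hrel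
  choose f hf using fun j => hp (m' j)
  have key : x = ∑ i, a (e i) • ((e i : F) - ∑ j, t i j • f j) := by
    have h0 : ∑ i, a (e i) • ∑ j, t i j • f j = 0 := by
      simp_rw [Finset.smul_sum, smul_smul]
      rw [Finset.sum_comm]
      simp_rw [← Finset.sum_smul, ht]
      simp
    simp_rw [smul_sub, Finset.sum_sub_distrib]
    rw [h0, sub_zero, hsum]
  rw [key]
  refine Submodule.sum_mem _ fun i _ => Submodule.smul_mem_smul (ha _) ?_
  rw [LinearMap.mem_ker, map_sub, hm' i, sub_eq_zero, map_sum]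
  simp [hf]

theorem IsEquationallyFlat.of_projective {S : Type u} [Ring S] {M : Type v}
    [AddCommGroup M] [Module S M] [Module.Projective S M] : IsEquationallyFlat S M := by
  classical
  obtain ⟨σ, hσ⟩ := Module.projective_def.1 ‹Module.Projective S M›
  intro n s m hm
  let T : Finset M := Finset.univ.biUnion fun i => (σ (m i)).support
  let e := T.equivFin.symm
  refine ⟨T.card, fun i j => σ (m i) (e j), fun j => e j, fun i => ?_, fun j => ?_⟩
  · have h1 := hσ (m i)
    rw [Finsupp.linearCombination_apply, Finsupp.sum_of_support_subset (s := T)] at h1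
    · rw [← Finset.sum_coe_sort] at h1
      exact h1.symm.trans (e.sum_comp (fun y : T => σ (m i) y • (y : M))).symm
    · exact Finset.subset_biUnion_of_mem (fun i => (σ (m i)).support) (Finset.mem_univ i)
    · simp
  · have h1 := DFunLike.congr_fun (congrArg σ hm) (e j : M)
    simpa [Finsupp.finsetSum_apply] using h1

/-- Read coordinatewise, a relation in a power is a family of syzygies of the `s i`. By coherence
finitely many syzygies `b j` generate them all; these give `t`, and the coefficients give `m'`. -/
theorem isEquationallyFlat_pi_of_isLeftCoherent {R : Type u} [Ring R] (hR : IsLeftCoherent R)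
    (ι : Type v) : IsEquationallyFlat Rᵐᵒᵖ (ι → R) := by
  intro n s m hm
  let φ : (Fin n → R) →ₗ[R] R := Fintype.linearCombination R fun i => (s i).unop
  have : Module.FinitePresentation R (LinearMap.range φ) := hR _ (Submodule.fg_range φ)
  have hfg := Module.FinitePresentation.fg_ker φ.rangeRestrict φ.surjective_rangeRestrict
  rw [LinearMap.ker_rangeRestrict] at hfg
  obtain ⟨k, b, hb⟩ := Submodule.fg_iff_exists_fin_generating_family.1 hfg
  have hmem : ∀ x, (fun i => m i x) ∈ Submodule.span R (Set.range b) := by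
    intro x
    rw [hb, LinearMap.mem_ker, Fintype.linearCombination_apply]
    simpa using congrFun hm x
  choose c hc using fun x => Submodule.mem_span_range_iff_exists_fun R |>.1 (hmem x)
  refine ⟨k, fun i j => MulOpposite.op (b j i), fun j x => c x j, fun i => ?_, fun j => ?_⟩
  · ext x
    simpa using (congrFun (hc x) i).symm
  · have : b j ∈ LinearMap.ker φ := hb ▸ Submodule.subset_span ⟨j, rfl⟩
    rw [LinearMap.mem_ker, Fintype.linearCombination_apply] at this
    apply MulOpposite.unop_injective
    simpa [Finset.unop_sum] using this

/-- The criterion is applied to the universal relation: the power is indexed by the syzygy module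
itself and `m i` is the `i`-th coordinate function. -/
theorem isLeftCoherent_of_isEquationallyFlat_pi {R : Type u} [Ring R]
    (h : ∀ ι : Type u, IsEquationallyFlat Rᵐᵒᵖ (ι → R)) : IsLeftCoherent R := by
  intro I hI
  obtain ⟨n, a, rfl⟩ := Submodule.fg_iff_exists_fin_generating_family.1 hI
  let φ : (Fin n → R) →ₗ[R] R := Fintype.linearCombination R a
  have hφ : LinearMap.range φ = Submodule.span R (Set.range a) :=
    Fintype.range_linearCombination R a
  rw [← hφ]
  refine Module.finitePresentation_of_surjective φ.rangeRestrict φ.surjective_rangeRestrict ?_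
  rw [LinearMap.ker_rangeRestrict]
  obtain ⟨k, t, m', hm', ht⟩ := h (LinearMap.ker φ) n (fun i => MulOpposite.op (a i))
    (fun i x => x.1 i) (by
      ext x
      have := x.2
      rw [LinearMap.mem_ker, Fintype.linearCombination_apply] at this
      simpa using this)
  refine Submodule.fg_iff_exists_fin_generating_family.2
    ⟨k, fun j i => (t i j).unop, le_antisymm (Submodule.span_le.2 ?_) ?_⟩
  · rintro _ ⟨j, rfl⟩
    have := congrArg MulOpposite.unop (ht j)
    simpa [φ, Fintype.linearCombination_apply, Finset.unop_sum] using this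
  · intro x hx
    refine (Submodule.mem_span_range_iff_exists_fun R).2 ⟨fun j => m' j ⟨x, hx⟩, ?_⟩
    ext i
    simpa using (congrFun (hm' i) ⟨x, hx⟩).symm

/-! ### Chase's argument: projective powers force the chain condition -/

/-- The descending chain condition on principal left ideals, in terms of generators. -/
def PrincipalLeftDCC (R : Type u) [Ring R] : Prop :=
  ∀ b : ℕ → R, (∀ n, ∃ a, b (n + 1) = a * b n) → ∃ n, ∃ c, b n = c * b (n + 1)

/-- A projective right module is a retract of a free one with basis indexed by itself. -/
theorem exists_retract_finsupp {R : Type u} [Ring R] (M : Type v) [AddCommGroup M] [Module Rᵐᵒᵖ M]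
    [Module.Projective Rᵐᵒᵖ M] :
    ∃ (σ : M →ₗ[Rᵐᵒᵖ] M →₀ R) (π : (M →₀ R) →ₗ[Rᵐᵒᵖ] M), ∀ m, π (σ m) = m := by
  obtain ⟨σ, hσ⟩ := Module.projective_def.1 ‹Module.Projective Rᵐᵒᵖ M›
  let e : (M →₀ R) ≃ₗ[Rᵐᵒᵖ] (M →₀ Rᵐᵒᵖ) :=
    Finsupp.mapRange.linearEquiv (MulOpposite.opLinearEquiv Rᵐᵒᵖ)
  exact ⟨e.symm.toLinearMap ∘ₗ σ, Finsupp.linearCombination Rᵐᵒᵖ id ∘ₗ e.toLinearMap,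
    fun m => by simpa using hσ m⟩

/-- A function whose entries are all left multiples of `c` is a right multiple by `c`. -/
theorem exists_op_smul_eq {R : Type u} [Ring R] {ι : Type v} (c : R) (f : ι → R)
    (hf : ∀ i, ∃ a, f i = a * c) : ∃ g : ι → R, f = MulOpposite.op c • g := by
  choose g hg using hf
  exact ⟨g, funext fun i => by simp [hg]⟩

theorem exists_eq_mul_of_le {R : Type u} [Ring R] {b : ℕ → R}
    (hb : ∀ n, ∃ a, b (n + 1) = a * b n) {m n : ℕ} (h : m ≤ n) : ∃ a, b n = a * b m := by
  induction n, h using Nat.le_induction with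
  | base => exact ⟨1, by simp⟩
  | succ n _ ih =>
    obtain ⟨a, ha⟩ := ih
    obtain ⟨c, hc⟩ := hb n
    exact ⟨c * a, by rw [hc, ha, mul_assoc]⟩

/-- If `f : R^(ℕ × W) → R^(X)` is a map of right modules and `R b₀ ⊇ R b₁ ⊇ ⋯`, then for some `n`
the map `f` carries the multiples by `b n` of vectors supported on `{n} × W` into `R b (n + 1)`,
up to finitely many coordinates. -/
theorem exists_finset_forall_notMem {R : Type u} [Ring R] {W : Type v} {X : Type w}
    (f : (ℕ × W → R) →ₗ[Rᵐᵒᵖ] (X →₀ R)) {b : ℕ → R} (hb : ∀ n, ∃ a, b (n + 1) = a * b n) :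
    ∃ (n : ℕ) (F : Finset X), ∀ y : W → R, ∀ x ∉ F,
      ∃ a, f (fun p => if p.1 = n then y p.2 * b n else 0) x = a * b (n + 1) := by
  classical
  by_contra! hcon
  choose Y x hx hne using hcon
  let z : ℕ → Finset X → ℕ × W → R := fun n F p => if p.1 = n then Y n F p.2 * b n else 0
  -- Counterexamples are chosen recursively: `G n` collects the supports of the earlier images, so
  -- the bad coordinates `ξ n` are distinct.
  let G : ℕ → Finset X := fun n => Nat.rec ∅ (fun n F => F ∪ (f (z n F)).support) n
  have hG : ∀ n, G (n + 1) = G n ∪ (f (z n (G n))).support := fun n => rfl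
  have hmono : Monotone G := monotone_nat_of_le_succ fun n => by
    rw [hG]; exact Finset.subset_union_left
  let ξ : ℕ → X := fun n => x n (G n)
  have hξ : ∀ n, ξ n ∉ G n := fun n => hx n (G n)
  have hξ' : ∀ n, ξ n ∈ G (n + 1) := by
    intro n
    rw [hG, Finset.mem_union, Finsupp.mem_support_iff]
    refine Or.inr fun h0 => hne n (G n) 0 ?_
    rw [zero_mul]
    exact h0
  have hinj : Function.Injective ξ := by
    have hlt : ∀ m n, m < n → ξ m ≠ ξ n := fun m n hmn h => hξ n (h ▸ hmono hmn (hξ' m))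
    intro m n h
    by_contra hmn
    rcases lt_or_gt_of_ne hmn with hmn | hmn
    exacts [hlt m n hmn h, hlt n m hmn h.symm]
  let Z : ℕ × W → R := fun p => z p.1 (G p.1) p
  have hZ : ∀ n, f Z (ξ n) ≠ 0 := by
    intro n h0
    -- Removing blocks `0, …, n` from `Z` leaves entries in `R b (n + 1)`. At `ξ n` the images of
    -- blocks below `n` vanish, so `f Z (ξ n) = 0` would put block `n` in `R b (n + 1)` there,
    -- against its choice.
    obtain ⟨g, hg⟩ := exists_op_smul_eq (b (n + 1)) (Z - ∑ k ∈ Finset.range (n + 1), z k (G k)) (by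
      rintro ⟨m, w⟩
      by_cases hm : m < n + 1
      · refine ⟨0, ?_⟩
        simp only [Pi.sub_apply, Finset.sum_apply, zero_mul, sub_eq_zero]
        rw [Finset.sum_eq_single_of_mem m (Finset.mem_range.2 hm)]
        intro k _ hk
        simp [z, hk.symm]
      · obtain ⟨a, ha⟩ := exists_eq_mul_of_le hb (not_lt.1 hm)
        refine ⟨Y m (G m) w * a, ?_⟩
        simp only [Pi.sub_apply, Finset.sum_apply]
        rw [Finset.sum_eq_zero, sub_zero]
        · simp [Z, z, ha, mul_assoc]
        · intro k hk
          have : m ≠ k := by have := Finset.mem_range.1 hk; omega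
          simp [z, this])
    have h1 := DFunLike.congr_fun (congrArg f hg) (ξ n)
    have h2 : ∑ k ∈ Finset.range n, f (z k (G k)) (ξ n) = 0 := by
      refine Finset.sum_eq_zero fun k hk => ?_
      by_contra hk0
      refine hξ n (hmono (Finset.mem_range.1 hk) ?_)
      rw [hG]
      exact Finset.mem_union_right _ (Finsupp.mem_support_iff.2 hk0)
    rw [map_sub, map_sum, map_smul, Finsupp.sub_apply, Finsupp.finsetSum_apply,
      Finset.sum_range_succ, h2, h0, zero_add, zero_sub, Finsupp.smul_apply, op_smul_eq_mul,
      neg_eq_iff_eq_neg, ← neg_mul] at h1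
    exact hne n (G n) _ h1
  exact (Set.infinite_range_of_injective hinj) ((f Z).support.finite_toSet.subset (by
    rintro _ ⟨n, rfl⟩
    simpa using hZ n))

/-- The index set `List R` is large enough for Cantor: two distinct subsets of it have indicator
vectors whose images agree on the finite exceptional set. The image of their difference lies in `R b
(n + 1)` everywhere, and retracting puts `b n` there too. -/
theorem principalLeftDCC_of_projective_pi {R : Type u} [Ring R]
    [Module.Projective Rᵐᵒᵖ (ℕ × List R → R)] : PrincipalLeftDCC R := by
  classical
  intro b hb
  obtain ⟨σ, π, hπ⟩ := exists_retract_finsupp (R := R) (ℕ × List R → R)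
  obtain ⟨n, F, hF⟩ := exists_finset_forall_notMem σ hb
  let ind : Set (List R) → List R → R := fun U w => if w ∈ U then 1 else 0
  let y : (List R → R) → ℕ × List R → R := fun v p => if p.1 = n then v p.2 * b n else 0
  let e := F.equivFin.symm
  let code : Set (List R) → List R := fun U => List.ofFn fun i => σ (y (ind U)) (e i)
  have hcode : ¬ Function.Injective code := Function.cantor_injective code
  simp only [Function.Injective, not_forall] at hcode
  obtain ⟨U, V, hUV, hne⟩ := hcode
  have hUV' : ∀ x ∈ F, σ (y (ind U)) x = σ (y (ind V)) x := by
    intro x hx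
    have := congrFun (List.ofFn_injective hUV) (e.symm ⟨x, hx⟩)
    simpa using this
  have hsub : y (ind U - ind V) = y (ind U) - y (ind V) := by
    funext p
    by_cases hp : p.1 = n <;> simp [y, hp, sub_mul]
  have hmul : ∀ x, ∃ a, σ (y (ind U - ind V)) x = a * b (n + 1) := by
    intro x
    by_cases hx : x ∈ F
    · exact ⟨0, by rw [hsub, map_sub, Finsupp.sub_apply, hUV' x hx, sub_self, zero_mul]⟩
    · exact hF _ x hx
  choose a ha using hmul
  let c : (ℕ × List R → R) →₀ R :=
    Finsupp.onFinset (σ (y (ind U - ind V))).support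
      -- The chosen `a x` need not vanish off the support, so it is cut off to keep `c` finitely
      -- supported.
      (fun x => if σ (y (ind U - ind V)) x = 0 then 0 else a x) (by
        intro x hx
        rw [Finsupp.mem_support_iff]
        intro h0
        simp [h0] at hx)
  have hc : σ (y (ind U - ind V)) = MulOpposite.op (b (n + 1)) • c := by
    ext x
    by_cases h0 : σ (y (ind U - ind V)) x = 0
    · simp [c, h0]
    · simp [c, h0, ← ha]
  have hy : y (ind U - ind V) = MulOpposite.op (b (n + 1)) • π c := by
    rw [← map_smul, ← hc, hπ]
  have hval : ∀ w, (ind U w - ind V w) * b n = π c (n, w) * b (n + 1) := by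
    intro w
    have := congrFun hy (n, w)
    simpa [y] using this
  obtain ⟨w, hw⟩ : ∃ w, ¬ (w ∈ U ↔ w ∈ V) := by
    by_contra! h
    exact hne (Set.ext h)
  refine ⟨n, ?_⟩
  by_cases hU : w ∈ U
  · have hV : w ∉ V := fun h => hw (by simp [hU, h])
    exact ⟨_, by simpa [ind, hU, hV] using hval w⟩
  · have hV : w ∈ V := by by_contra h; exact hw (by simp [hU, h])
    exact ⟨-π c (n, w), by
      rw [neg_mul, ← hval w]
      simp [ind, hU, hV]⟩

/-! ### Rings with the chain condition on principal left ideals -/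

theorem PrincipalLeftDCC.of_surjective {R : Type u} {S : Type v} [Ring R] [Ring S] (φ : R →+* S)
    (hφ : Function.Surjective φ) (h : PrincipalLeftDCC R) : PrincipalLeftDCC S := by
  intro b hb
  choose a ha using hb
  choose l hl using hφ
  let b' : ℕ → R := fun n => Nat.rec (l (b 0)) (fun n r => l (a n) * r) n
  have hb' : ∀ n, φ (b' n) = b n := by
    intro n
    induction n with
    | zero => exact hl _
    | succ n ih =>
      change φ (l (a n) * b' n) = _
      rw [map_mul, hl, ih, ha]
  obtain ⟨n, c, hc⟩ := h b' fun n => ⟨l (a n), rfl⟩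
  exact ⟨n, φ c, by rw [← hb', hc, map_mul, hb' (n + 1)]⟩

theorem PrincipalLeftDCC.wellFounded {R : Type u} [Ring R] (h : PrincipalLeftDCC R) :
    WellFounded fun x y : R => Ideal.span {x} < Ideal.span {y} := by
  have : IsStrictOrder R fun x y : R => Ideal.span {x} < Ideal.span {y} :=
    { irrefl := fun _ => lt_irrefl _
      trans := fun _ _ _ => lt_trans }
  rw [RelEmbedding.wellFounded_iff_isEmpty]
  refine ⟨fun b => ?_⟩
  have hlt : ∀ n, Ideal.span {b (n + 1)} < Ideal.span {b n} := fun n =>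
    b.map_rel_iff.2 (Nat.lt_succ_self n)
  obtain ⟨n, c, hc⟩ := h b fun n => by
    obtain ⟨a, ha⟩ := Ideal.mem_span_singleton'.1
      ((hlt n).le (Ideal.mem_span_singleton_self (b (n + 1))))
    exact ⟨a, ha.symm⟩
  refine (hlt n).not_ge ((Ideal.span_singleton_le_iff_mem _).2 ?_)
  exact Ideal.mem_span_singleton'.2 ⟨c, hc.symm⟩

theorem PrincipalLeftDCC.exists_isAtom_le {R : Type u} [Ring R] (h : PrincipalLeftDCC R) {x : R}
    (hx : x ≠ 0) : ∃ L : Ideal R, IsAtom L ∧ L ≤ Ideal.span {x} := by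
  obtain ⟨y, ⟨hy0, hyx⟩, hmin⟩ := h.wellFounded.has_min
    {y | y ≠ 0 ∧ y ∈ Ideal.span {x}} ⟨x, hx, Ideal.mem_span_singleton_self x⟩
  have hyx' : Ideal.span {y} ≤ Ideal.span {x} := (Ideal.span_singleton_le_iff_mem _).2 hyx
  refine ⟨Ideal.span {y}, ⟨by simpa using hy0, fun N hN => ?_⟩, hyx'⟩
  by_contra hN0
  obtain ⟨z, hz, hz0⟩ := Submodule.exists_mem_ne_zero_of_ne_bot hN0
  exact hmin z ⟨hz0, hyx' (hN.le hz)⟩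
    (((Ideal.span_singleton_le_iff_mem _).2 hz).trans_lt hN)

/-- A ring with the descending chain condition on principal left ideals and zero Jacobson radical
is semisimple. -/
theorem PrincipalLeftDCC.isSemisimpleRing {R : Type u} [Ring R] (h : PrincipalLeftDCC R)
    (hJ : Ring.jacobson R = ⊥) : IsSemisimpleRing R := by
  -- `R x` is a minimal principal summand with semisimple complement. If `x ≠ 0`, a minimal left
  -- ideal `L ≤ R x` avoids some maximal `m`, and moving `L` to the complement leaves the smaller
  -- summand `R x ⊓ m`.
  obtain ⟨x, ⟨C, hC, hcompl⟩, hmin⟩ := h.wellFounded.has_min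
    {x | ∃ C : Ideal R, IsSemisimpleModule R C ∧ IsCompl (Ideal.span {x}) C}
    ⟨1, ⊥, (isSemisimpleModule_iff R _).2 Subsingleton.instComplementedLattice, by rw [Ideal.span_singleton_one]; exact isCompl_top_bot⟩
  by_cases hx : x = 0
  · have hCtop : C = ⊤ := by simpa [hx] using hcompl.sup_eq_top
    subst hCtop
    exact (Submodule.topEquiv (R := R) (M := R)).isSemisimpleModule_iff.1 hC
  obtain ⟨L, hL, hLx⟩ := h.exists_isAtom_le hx
  obtain ⟨m, hm, hLm⟩ : ∃ m : Ideal R, m.IsMaximal ∧ ¬ L ≤ m := by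
    by_contra! hall
    apply hL.1
    rw [eq_bot_iff, ← hJ, Ring.jacobson_eq_sInf_isMaximal]
    exact le_sInf fun m hm => hall m hm
  have hd : Disjoint L m := hL.not_le_iff_disjoint.1 hLm
  have hs : L ⊔ m = ⊤ := by
    refine (Ideal.isMaximal_def.1 hm).2 _ (right_lt_sup.2 hLm)
  let N : Ideal R := Ideal.span {x} ⊓ m
  have hLN : L ⊔ N = Ideal.span {x} := by
    change L ⊔ Ideal.span {x} ⊓ m = _
    rw [inf_comm, ← sup_inf_assoc_of_le m hLx, hs, top_inf_eq]
  have hLss : IsSemisimpleModule R L :=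
    have := isSimpleModule_iff_isAtom.2 hL
    inferInstance
  have hNL : Disjoint N L := (hd.mono_right inf_le_right).symm
  have hNC : IsCompl N (L ⊔ C) := by
    refine ⟨hNL.disjoint_sup_right_of_disjoint_sup_left ?_, ?_⟩
    · rw [sup_comm, hLN]
      exact hcompl.disjoint
    · rw [codisjoint_iff, ← sup_assoc, sup_comm N L, hLN, hcompl.sup_eq_top]
  -- As a direct summand of `R`, `N` is generated by its component `e` of `1`.
  obtain ⟨e, he, c, hc, hec⟩ := Submodule.mem_sup.1
    (hNC.sup_eq_top.ge (Submodule.mem_top (x := (1 : R))))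
  have hNe : N = Ideal.span {e} := by
    refine le_antisymm (fun r hr => ?_) ((Ideal.span_singleton_le_iff_mem _).2 he)
    have h1 : r - r * e = r * c := by
      rw [sub_eq_iff_eq_add, add_comm, ← mul_add, hec, mul_one]
    have h2 : r - r * e = 0 := (Submodule.disjoint_def.1 hNC.disjoint) _
      (N.sub_mem hr (N.mul_mem_left r he)) (h1 ▸ (L ⊔ C).mul_mem_left r hc)
    exact Ideal.mem_span_singleton'.2 ⟨r, (sub_eq_zero.1 h2).symm⟩
  exact absurd (hNe ▸ lt_of_le_of_ne inf_le_left fun hEq =>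
    hL.1 (disjoint_self.1 (hNL.mono_left (hLx.trans hEq.ge))))
    (hmin e ⟨L ⊔ C, IsSemisimpleModule.sup hLss hC, hNe ▸ hNC⟩)

/-! ### Consequences of projective submodules of powers -/

/-- Every submodule of a power of the right module `R` is projective. -/
def ProjectiveSubmodulesOfPowers (R : Type u) [Ring R] : Prop :=
  ∀ (ι : Type u) (N : Submodule Rᵐᵒᵖ (ι → R)), Module.Projective Rᵐᵒᵖ N

theorem ProjectiveSubmodulesOfPowers.projective_pi {R : Type u} [Ring R]
    (h : ProjectiveSubmodulesOfPowers R) (ι : Type u) : Module.Projective Rᵐᵒᵖ (ι → R) :=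
  have := h ι ⊤
  .of_equiv (Submodule.topEquiv (R := Rᵐᵒᵖ) (M := ι → R))

theorem exists_mul_one_sub_eq_one {R : Type u} [Ring R] {a : R} (ha : a ∈ Ring.jacobson R) (c : R) :
    ∃ z, z * (1 - c * a) = 1 := by
  rw [← Ideal.jacobson_bot, Ideal.mem_jacobson_iff] at ha
  obtain ⟨z, hz⟩ := ha (-c)
  refine ⟨z, ?_⟩
  rw [Ideal.mem_bot, sub_eq_zero] at hz
  have : z * (1 - c * a) = z * -c * a + z := by noncomm_ring
  rw [this, hz]

/-- Under the descending chain condition on principal left ideals, the Jacobson radical is right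
T-nilpotent. -/
theorem PrincipalLeftDCC.exists_eq_zero {R : Type u} [Ring R] (h : PrincipalLeftDCC R) {b : ℕ → R}
    (hb : ∀ n, ∃ a ∈ Ring.jacobson R, b (n + 1) = a * b n) : ∃ n, b n = 0 := by
  obtain ⟨n, c, hc⟩ := h b fun n => (hb n).imp fun _ => And.right
  obtain ⟨a, ha, hab⟩ := hb n
  obtain ⟨z, hz⟩ := exists_mul_one_sub_eq_one ha c
  refine ⟨n, ?_⟩
  have h0 : (1 - c * a) * b n = 0 := by
    rw [sub_mul, one_mul, mul_assoc, ← hab, ← hc, sub_self]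
  rw [← one_mul (b n), ← hz, mul_assoc, h0, mul_zero]

/-- The right annihilator of a two-sided ideal, as a left ideal. -/
def rightAnnihilator {R : Type u} [Ring R] (I : Ideal R) [I.IsTwoSided] : Ideal R where
  carrier := {r | ∀ x ∈ I, x * r = 0}
  add_mem' hr hs x hx := by rw [mul_add, hr x hx, hs x hx, add_zero]
  zero_mem' x _ := mul_zero x
  smul_mem' s r hr x hx := by
    rw [smul_eq_mul, ← mul_assoc]
    exact hr _ (I.mul_mem_right s hx)

theorem mul_mem_rightAnnihilator {R : Type u} [Ring R] {I : Ideal R} [I.IsTwoSided] {r : R}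
    (hr : r ∈ rightAnnihilator I) (s : R) : r * s ∈ rightAnnihilator I := fun x hx => by
  rw [← mul_assoc, hr x hx, zero_mul]

/-- A right annihilator is generated, as a right ideal, by an idempotent. -/
theorem ProjectiveSubmodulesOfPowers.exists_mul_eq_self {R : Type u} [Ring R]
    (h : ProjectiveSubmodulesOfPowers R) (I : Ideal R) [I.IsTwoSided] :
    ∃ g ∈ rightAnnihilator I, ∀ r ∈ rightAnnihilator I, g * r = r := by
  -- The right annihilator is the kernel of `f`, whose image is projective; a splitting `t` makes it
  -- a summand of `R`.
  let f : R →ₗ[Rᵐᵒᵖ] (I → R) :=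
    { toFun := fun r x => x * r
      map_add' := fun r s => funext fun x => mul_add _ _ _
      map_smul' := fun s r => funext fun x => by simp [mul_assoc] }
  have := h I (LinearMap.range f)
  obtain ⟨t, ht⟩ := Module.projective_lifting_property f.rangeRestrict LinearMap.id
    f.surjective_rangeRestrict
  have hf : ∀ r, r ∈ rightAnnihilator I ↔ f r = 0 := fun r =>
    ⟨fun hr => funext fun x => hr x x.2, fun hr x hx => congrFun hr ⟨x, hx⟩⟩
  have hft : ∀ y, f (t y) = y := fun y => congrArg Subtype.val (LinearMap.congr_fun ht y)
  refine ⟨1 - t (f.rangeRestrict 1), (hf _).2 ?_, fun r hr => ?_⟩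
  · rw [map_sub, hft]
    exact sub_self _
  · have h1 : t (f.rangeRestrict 1) * r = t (f.rangeRestrict r) := by
      have : r = MulOpposite.op r • (1 : R) := by simp
      conv_rhs => rw [this, map_smul, map_smul]
      simp
    have h2 : f.rangeRestrict r = 0 := Subtype.ext ((hf r).1 hr)
    rw [sub_mul, h1, h2, map_zero, one_mul, sub_zero]

theorem eq_zero_of_mul_self_of_mem_jacobson {R : Type u} [Ring R] {c : R} (hc : c * c = c)
    (hcJ : c ∈ Ring.jacobson R) : c = 0 := by
  obtain ⟨z, hz⟩ := exists_mul_one_sub_eq_one hcJ 1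
  rw [one_mul] at hz
  rw [← one_mul c, ← hz, mul_assoc, sub_mul, hc, one_mul, sub_self, mul_zero]

/-- With idempotent generators `g`, `h` of the two annihilators, `h - g * h` is an idempotent in the
radical, hence zero. -/
theorem ProjectiveSubmodulesOfPowers.rightAnnihilator_le {R : Type u} [Ring R]
    (hP : ProjectiveSubmodulesOfPowers R) {I I' : Ideal R} [I.IsTwoSided] [I'.IsTwoSided]
    (hle : rightAnnihilator I ≤ rightAnnihilator I')
    (hmod : ∀ r ∈ rightAnnihilator I', ∃ s ∈ rightAnnihilator I, r - s ∈ Ring.jacobson R) :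
    rightAnnihilator I' ≤ rightAnnihilator I := by
  obtain ⟨g, hg, hgr⟩ := hP.exists_mul_eq_self I
  obtain ⟨h, hh, hhr⟩ := hP.exists_mul_eq_self I'
  obtain ⟨s, hs, hsJ⟩ := hmod h hh
  have hgh : h * g = g := hhr g (hle hg)
  have hhh : h * h = h := hhr h hh
  have hgg : g * g = g := hgr g hg
  have hc : h - g * h = 0 := by
    apply eq_zero_of_mul_self_of_mem_jacobson
    · have : (h - g * h) * (h - g * h) = h * h - h * g * h - g * (h * h) + g * (h * g) * h := by
        noncomm_ring
      rw [this, hgh, hhh, hgg]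
      abel
    · have : h - g * h = (1 - g) * (h - s) := by
        have := hgr s hs
        rw [sub_mul, one_mul, mul_sub, this]
        abel
      rw [this]
      exact Ideal.mul_mem_left _ _ hsJ
  intro r hr
  rw [← hhr r hr, sub_eq_zero.1 hc, mul_assoc]
  exact mul_mem_rightAnnihilator hg _

/-- The annihilators `A n` of the powers of `J` stabilise modulo `J`, hence stabilise. Then `J x ⊆ A
n` forces `x ∈ A n`; so if `1 ∉ A n`, multiplying by elements of `J` yields an endless sequence
outside `A n`, against T-nilpotency. -/
theorem ProjectiveSubmodulesOfPowers.isSemiprimaryRing {R : Type u} [Ring R]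
    (hP : ProjectiveSubmodulesOfPowers R) : IsSemiprimaryRing R := by
  have := hP.projective_pi (ℕ × List R)
  have hD : PrincipalLeftDCC R := principalLeftDCC_of_projective_pi
  set J := Ring.jacobson R with hJ
  have hss : IsSemisimpleRing (R ⧸ J) :=
    (hD.of_surjective (Ideal.Quotient.mk J) Ideal.Quotient.mk_surjective).isSemisimpleRing
      (Ring.jacobson_quotient_jacobson R)
  let A : ℕ → Ideal R := fun n => rightAnnihilator (J ^ n)
  have hA : Monotone A := fun m n hmn r hr x hx => hr x (Ideal.pow_le_pow_right hmn hx)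
  obtain ⟨n, hn⟩ := monotone_stabilizes_iff_noetherian.2
    (inferInstanceAs (IsNoetherian (R ⧸ J) (R ⧸ J)))
    ⟨fun n => (A n).map (Ideal.Quotient.mk J), fun _ _ h => Ideal.map_mono (hA h)⟩
  have hstab : A (n + 1) ≤ A n := by
    refine hP.rightAnnihilator_le (hA n.le_succ) fun r hr => ?_
    have hmem : Ideal.Quotient.mk J r ∈ (A n).map (Ideal.Quotient.mk J) :=
      (hn (n + 1) n.le_succ).ge (Ideal.mem_map_of_mem _ hr)
    obtain ⟨s, hs, hsr⟩ :=
      (Ideal.mem_map_iff_of_surjective _ Ideal.Quotient.mk_surjective).1 hmem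
    exact ⟨s, hs, Ideal.Quotient.eq.1 hsr.symm⟩
  refine ⟨hss, n, ?_⟩
  by_contra hne
  have h1 : (1 : R) ∉ A n := fun h1 => hne ((Submodule.eq_bot_iff _).2 fun x hx => by
    simpa using h1 x hx)
  have hstep : ∀ x : {x // x ∉ A n}, ∃ y : {x // x ∉ A n}, ∃ a ∈ J, (y : R) = a * x := by
    rintro ⟨x, hx⟩
    by_contra! hcon
    refine hx (hstab fun y hy => ?_)
    rw [Submodule.pow_succ] at hy
    refine Submodule.mul_induction_on hy (fun p hp a ha => ?_) fun p q hp hq => ?_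
    · rw [mul_assoc]
      by_contra h0
      exact hcon ⟨a * x, fun hax => h0 (hax p hp)⟩ a ha rfl
    · rw [add_mul, hp, hq, add_zero]
  choose next hnext using hstep
  let b : ℕ → {x // x ∉ A n} := fun k => Nat.rec ⟨1, h1⟩ (fun _ => next) k
  let b' : ℕ → R := fun k => (b k).1
  have hb' : ∀ k, ∃ a ∈ J, b' (k + 1) = a * b' k := fun k => hnext (b k)
  obtain ⟨k, hk⟩ := hD.exists_eq_zero hb'
  exact (b k).2 (show b' k ∈ A n from hk ▸ (A n).zero_mem)

theorem ProjectiveSubmodulesOfPowers.isRightHereditary {R : Type u} [Ring R]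
    (h : ProjectiveSubmodulesOfPowers R) : IsRightHereditary R := by
  intro P hP N
  obtain ⟨σ, π, hπ⟩ := exists_retract_finsupp (R := R) P
  let f : N →ₗ[Rᵐᵒᵖ] (P → R) := Finsupp.lcoeFun ∘ₗ σ ∘ₗ N.subtype
  have hf : Function.Injective f := by
    intro x y hxy
    have : σ x = σ y := DFunLike.coe_injective hxy
    exact Subtype.ext (by rw [← hπ x, this, hπ])
  have := h P (LinearMap.range f)
  exact .of_equiv (LinearEquiv.ofInjective f hf).symm

theorem ProjectiveSubmodulesOfPowers.isLeftCoherent {R : Type u} [Ring R]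
    (h : ProjectiveSubmodulesOfPowers R) : IsLeftCoherent R :=
  isLeftCoherent_of_isEquationallyFlat_pi fun ι =>
    have := h.projective_pi ι
    .of_projective

/-! ### Semiprimary, hereditary and coherent rings -/

/-- The Jacobson radical of `R` as an ideal of the opposite ring. -/
abbrev opJacobson (R : Type u) [Ring R] : Ideal Rᵐᵒᵖ :=
  RingHom.ker (Ideal.Quotient.mk (Ring.jacobson R)).op

theorem mem_opJacobson {R : Type u} [Ring R] {x : Rᵐᵒᵖ} :
    x ∈ opJacobson R ↔ x.unop ∈ Ring.jacobson R := by
  rw [RingHom.mem_ker, ← Ideal.Quotient.eq_zero_iff_mem]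
  exact MulOpposite.op_eq_zero_iff _

theorem isNilpotent_opJacobson {R : Type u} [Ring R] (h : IsNilpotent (Ring.jacobson R)) :
    IsNilpotent (opJacobson R) := by
  have key : ∀ n, ∀ x ∈ opJacobson R ^ n, x.unop ∈ Ring.jacobson R ^ n := by
    intro n
    induction n with
    | zero => simp [Submodule.pow_zero, Ideal.one_eq_top]
    | succ n ih =>
      intro x hx
      rw [Submodule.pow_succ] at hx
      -- `unop` reverses products, so the factor must be split off on the other side.
      rw [Ideal.IsTwoSided.pow_succ]
      refine Submodule.mul_induction_on hx (fun p hp q hq => ?_) fun p q hp hq => ?_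
      · exact Ideal.mul_mem_mul (mem_opJacobson.1 hq) (ih p hp)
      · exact Ideal.add_mem _ hp hq
  obtain ⟨n, hn⟩ := h
  refine ⟨n, (Submodule.eq_bot_iff _).2 fun x hx => ?_⟩
  have := key n x hx
  rw [hn] at this
  exact MulOpposite.unop_injective (by simpa using this)

theorem isSemisimpleModule_quotient_opJacobson {R : Type u} [Ring R] [IsSemiprimaryRing R]
    (F : Type v) [AddCommGroup F] [Module Rᵐᵒᵖ F] :
    IsSemisimpleModule Rᵐᵒᵖ (F ⧸ (opJacobson R • ⊤ : Submodule Rᵐᵒᵖ F)) := by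
  have htor : Module.IsTorsionBySet Rᵐᵒᵖ (F ⧸ (opJacobson R • ⊤ : Submodule Rᵐᵒᵖ F))
      (opJacobson R) :=
    (Module.isTorsionBySet_quotient_iff _ _).2 fun m i hi => Submodule.smul_mem_smul hi trivial
  have hsurj : Function.Surjective (Ideal.Quotient.mk (Ring.jacobson R)).op := by
    intro x
    obtain ⟨r, hr⟩ := Ideal.Quotient.mk_surjective x.unop
    exact ⟨MulOpposite.op r, MulOpposite.unop_injective hr⟩
  have : IsSemisimpleRing (Rᵐᵒᵖ ⧸ opJacobson R) :=
    (RingHom.quotientKerEquivOfSurjective hsurj).symm.isSemisimpleRing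
  let _ := htor.module
  exact htor.isSemisimpleModule_iff.1 inferInstance

theorem projectiveSubmodulesOfPowers_of_isSemiprimaryRing {R : Type u} [Ring R]
    [hs : IsSemiprimaryRing R] (hh : IsRightHereditary R) (hc : IsLeftCoherent R) :
    ProjectiveSubmodulesOfPowers R := by
  intro ι N
  refine hh (ModuleCat.of Rᵐᵒᵖ (ι → R)) ?_ N
  have := isSemisimpleModule_quotient_opJacobson (R := R) ((ι → R) →₀ Rᵐᵒᵖ)
  have hp := Finsupp.linearCombination_surjective Rᵐᵒᵖ (Function.surjective_id (α := ι → R))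
  exact projective_of_ker_inf_smul_top_le (isNilpotent_opJacobson hs.isNilpotent) hp
    ((isEquationallyFlat_pi_of_isLeftCoherent hc ι).ker_inf_smul_top_le hp)

/-! ### Subprojectivity domains and torsion theories -/

variable {R : Type u} [Ring R]

theorem mem_subprojDomain_of_projective {M N : RMod R} (h : Module.Projective Rᵐᵒᵖ N) :
    N ∈ subprojDomain M := by
  intro B g hg f
  obtain ⟨s, hs⟩ := Module.projective_lifting_property g LinearMap.id hg
  exact ⟨s ∘ₗ f, by rw [← LinearMap.comp_assoc, hs, LinearMap.id_comp]⟩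

theorem projective_of_mem_subprojDomain_self {N : RMod R} (h : N ∈ subprojDomain N) :
    Module.Projective Rᵐᵒᵖ N := by
  obtain ⟨s, hs⟩ := h (ModuleCat.of Rᵐᵒᵖ (N →₀ Rᵐᵒᵖ)) (Finsupp.linearCombination Rᵐᵒᵖ id)
    (Finsupp.linearCombination_surjective _ Function.surjective_id) LinearMap.id
  exact Module.projective_def'.2 ⟨s, hs⟩

/-- The right module `R` is projective. -/
theorem projective_self_op : Module.Projective Rᵐᵒᵖ R :=
  .of_equiv (MulOpposite.opLinearEquiv Rᵐᵒᵖ).symm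

/-- If `Hom(K, R) = 0` then `K` is `N`-subprojective exactly when `Hom(K, N) = 0`. -/
theorem subprojDomain_eq_of_homZero_self {K : RMod R} (hK : ∀ f : K →ₗ[Rᵐᵒᵖ] R, f = 0) :
    subprojDomain K = {N | HomZero K N} := by
  ext N
  refine ⟨fun h f => ?_, fun h B g _ f => ⟨0, by rw [h f, LinearMap.comp_zero]⟩⟩
  obtain ⟨s, rfl⟩ := h (ModuleCat.of Rᵐᵒᵖ (N →₀ Rᵐᵒᵖ)) (Finsupp.linearCombination Rᵐᵒᵖ id)
    (Finsupp.linearCombination_surjective _ Function.surjective_id) f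
  have hs : s = 0 := by
    ext k : 1
    refine Finsupp.ext fun n => MulOpposite.unop_injective ?_
    exact LinearMap.congr_fun (hK ((MulOpposite.opLinearEquiv Rᵐᵒᵖ).symm.toLinearMap ∘ₗ
      Finsupp.lapply n ∘ₗ s)) k
  rw [hs, LinearMap.comp_zero]

/-- Every module has a direct summand without nonzero maps to `R` whose complement is projective. -/
theorem ProjectiveSubmodulesOfPowers.isBasic (hP : ProjectiveSubmodulesOfPowers R) (M : RMod R) :
    IsBasic (subprojDomain M) := by
  -- `K` is the common kernel of all maps `M → R`; since `Q` is projective, `t` splits `M` as `K ⊕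
  -- Q`, with projection `e` onto `K`.
  let Φ : M →ₗ[Rᵐᵒᵖ] ((M →ₗ[Rᵐᵒᵖ] R) → R) := LinearMap.pi fun f => f
  let K := LinearMap.ker Φ
  let Q := LinearMap.range Φ
  have := hP _ Q
  obtain ⟨t, ht⟩ := Module.projective_lifting_property Φ.rangeRestrict LinearMap.id
    Φ.surjective_rangeRestrict
  have ht' : ∀ q, Φ.rangeRestrict (t q) = q := LinearMap.congr_fun ht
  let e : M →ₗ[Rᵐᵒᵖ] K := (LinearMap.id - t ∘ₗ Φ.rangeRestrict).codRestrict K fun m => by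
    change Φ (m - t (Φ.rangeRestrict m)) = 0
    rw [map_sub, sub_eq_zero]
    exact (congrArg Subtype.val (ht' (Φ.rangeRestrict m))).symm
  have he : ∀ k : K, e k = k := by
    intro k
    have h0 : Φ.rangeRestrict k = 0 := Subtype.ext k.2
    apply Subtype.ext
    change (k : M) - t (Φ.rangeRestrict k) = k
    rw [h0, map_zero, sub_zero]
  have hsum : ∀ m, (e m : M) + t (Φ.rangeRestrict m) = m := fun m => sub_add_cancel _ _
  have hK : ∀ f : K →ₗ[Rᵐᵒᵖ] R, f = 0 := by
    intro f
    ext k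
    -- A map `f : K → R` extends to `f ∘ₗ e` on `M`, which vanishes on `K` by definition of `K`.
    have := congrFun (show Φ k = 0 from k.2) (f ∘ₗ e)
    rw [← he k]
    exact this
  refine ⟨ModuleCat.of Rᵐᵒᵖ K, ?_, subprojDomain_eq_of_homZero_self hK⟩
  ext N
  refine ⟨fun h B g hg f => ?_, fun h B g hg f => ?_⟩
  · obtain ⟨l, hl⟩ := h B g hg (f ∘ₗ e)
    refine ⟨l ∘ₗ K.subtype, LinearMap.ext fun k => ?_⟩
    have := LinearMap.congr_fun hl (k : M)
    exact this.trans (congrArg f (he k))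
  · obtain ⟨l, hl⟩ := h B g hg (f ∘ₗ K.subtype)
    obtain ⟨l', hl'⟩ := Module.projective_lifting_property g (f ∘ₗ t) hg
    refine ⟨l ∘ₗ e + l' ∘ₗ Φ.rangeRestrict, LinearMap.ext fun m => ?_⟩
    have h1 := LinearMap.congr_fun hl (e m)
    have h2 := LinearMap.congr_fun hl' (Φ.rangeRestrict m)
    change g (l (e m) + l' (Φ.rangeRestrict m)) = f m
    rw [map_add]
    refine (congrArg₂ (· + ·) h1 h2).trans ?_
    change f (e m) + f (t (Φ.rangeRestrict m)) = f m
    rw [← map_add, hsum]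

/-- The torsion class is the left orthogonal of `C`; it contains `M`, so its right orthogonal is no
larger than `C`. -/
theorem IsBasic.isTorsionFreeClass {C : Set (RMod R)} (h : IsBasic C) : IsTorsionFreeClass C := by
  obtain ⟨M, hC, hM⟩ := h
  have hmem : ∀ N, N ∈ C ↔ HomZero M N := fun N => by rw [hC, hM]; rfl
  exact ⟨{A | ∀ N ∈ C, HomZero A N}, fun A hA N hN => hA N hN, fun _ hA => hA,
    fun B hB => (hmem B).2 (hB M fun N hN => (hmem N).1 hN)⟩

/-- The domain of `N` contains the projective module `R`. Maps from torsion modules into `N` vanish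
coordinatewise, so `N` lies in its own domain. -/
theorem projectiveSubmodulesOfPowers_of_isTorsionFreeClass
    (h : ∀ C : Set (RMod R), IsSpPortfolio C → IsTorsionFreeClass C) :
    ProjectiveSubmodulesOfPowers R := by
  intro ι N
  let X : RMod R := ModuleCat.of Rᵐᵒᵖ N
  obtain ⟨T, hT⟩ := h (subprojDomain X) ⟨X, rfl⟩
  refine projective_of_mem_subprojDomain_self (N := X) (hT.mem_torsionFree X fun M hM f => ?_)
  ext m i
  have hR : ModuleCat.of Rᵐᵒᵖ R ∈ subprojDomain X :=
    mem_subprojDomain_of_projective projective_self_op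
  exact LinearMap.congr_fun (hT.homZero M hM _ hR (LinearMap.proj i ∘ₗ N.subtype ∘ₗ f)) m

end Subproj

theorem mainTheorem3 (R : Type u) [Ring R] :
    List.TFAE
      [IsSemiprimaryRing R ∧ Subproj.IsRightHereditary R ∧ Subproj.IsLeftCoherent R,
        ∀ C : Set (Subproj.RMod R), Subproj.IsSpPortfolio C → Subproj.IsBasic C,
        ∀ C : Set (Subproj.RMod R), Subproj.IsSpPortfolio C → Subproj.IsTorsionFreeClass C] := by
  tfae_have 1 → 2
  | ⟨_, hh, hc⟩, _, ⟨M, hM⟩ =>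
    hM ▸ (Subproj.projectiveSubmodulesOfPowers_of_isSemiprimaryRing hh hc).isBasic M
  tfae_have 2 → 3 := fun h C hC => (h C hC).isTorsionFreeClass
  tfae_have 3 → 1 := fun h =>
    have hP := Subproj.projectiveSubmodulesOfPowers_of_isTorsionFreeClass h
    ⟨hP.isSemiprimaryRing, hP.isRightHereditary, hP.isLeftCoherent⟩
  tfae_finish
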